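/- Let $M$ be a finitely generated abelian group, $S$ a scheme, $X$ a separated algebraic space over $S$, and let the diagonalizable group scheme $D(M)_S=\operatorname{Spec}(\mathbb{Z}[M])\times S$ act on $X$ over $S$. For a submonoid $N\subseteq M$ (a \emph{magnet}) put $A(N)_T=\operatorname{Spec}(\mathbb{Z}[N])\times T$, on which $D(M)_T$ acts by multiplication through the morphism $D(M)_T\to A(N)_T$ induced by $N\subseteq M$. Let $X^N$ be the functor sending an $S$-scheme $T$ to the set of $D(M)_T$-equivariant $T$-morphisms $A(N)_T\to X_T$, regarded as a subfunctor of $X$ through evaluation at the unit section $1$ of $A(N)_T$. Similarly, for an action of $\mathbb{G}_{m,S}$ on $X$, let $X^+$ be the functor sending $T$ to the set of $\mathbb{G}_{m,T}$-equivariant $T$-morphisms $\mathbb{A}^1_T\to X_T$, where $\mathbb{G}_{m,T}$ acts on $\mathbb{A}^1_T$ by multiplication, regarded as a subfunctor of $X$ through evaluation at $1$. A magnet $N$ is called \emph{lambdafiable} (for the given action) if there is a group homomorphism $f:M\to\mathbb{Z}$ such that $X^{f^{-1}(\mathbb{N})}=X^N$ as subfunctors of $X$, where $\mathbb{N}=\{0,1,2,\dots\}$.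 If $N\subseteq M$ is lambdafiable, then there exists a homomorphism of group schemes $\lambda:\mathbb{G}_{m,S}\to D(M)_S$ over $S$ such that $X^+=X^N$ as subfunctors of $X$, where $X^+$ is formed with respect to the action of $\mathbb{G}_{m,S}$ on $X$ obtained from the given action of $D(M)_S$ through $\lambda$. -/

import Mathlib

open CategoryTheory Limits Opposite AlgebraicGeometry MonoidalCategory CartesianMonoidalCategory
open scoped MonObj

universe u

noncomputable section

namespace Magnetism

/-! ### Diagonalizable monoid and group schemes -/

section Diagonalizable

/-- The ring `ℤ[N]` of an additive commutative monoid `N` (with `ℤ` placed in the universe `u`). -/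
abbrev intAlg (N : Type u) [AddCommMonoid N] : CommRingCat.{u} :=
  CommRingCat.of (AddMonoidAlgebra (ULift.{u} ℤ) N)

variable (N : Type u) [AddCommMonoid N]

lemma intAlg_hom_ext {N : Type u} [AddCommMonoid N] {R : CommRingCat.{u}} {f g : intAlg N ⟶ R}
    (h : ∀ n : N, f (AddMonoidAlgebra.single n 1) = g (AddMonoidAlgebra.single n 1)) : f = g := by
  ext : 1
  refine AddMonoidAlgebra.ringHom_ext (fun r => ?_) h
  have : (f.hom.comp AddMonoidAlgebra.singleZeroRingHom).comp
        (ULift.ringEquiv.symm : ℤ ≃+* ULift.{u} ℤ).toRingHom =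
      (g.hom.comp AddMonoidAlgebra.singleZeroRingHom).comp
        (ULift.ringEquiv.symm : ℤ ≃+* ULift.{u} ℤ).toRingHom := RingHom.ext_int _ _
  exact DFunLike.congr_fun this r.down

/-- The ring homomorphism `ℤ[N] ⟶ R` extending a monoid homomorphism `N → (R, ·)`. -/
def charLift (R : CommRingCat.{u}) (χ : Multiplicative N →* R) : intAlg N ⟶ R :=
  CommRingCat.ofHom (AddMonoidAlgebra.liftNCRingHom
    ((Int.castRingHom R).comp ULift.ringEquiv.toRingHom) χ (fun _ _ => Commute.all _ _))

lemma charLift_single (R : CommRingCat.{u}) (χ : Multiplicative N →* R) (n : N) :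
    charLift N R χ (AddMonoidAlgebra.single n 1) = χ (Multiplicative.ofAdd n) := by
  have key (φ : ULift.{u} ℤ →+* R) : AddMonoidAlgebra.liftNCRingHom φ χ
      (fun _ _ => Commute.all _ _) (AddMonoidAlgebra.single n 1) = χ (Multiplicative.ofAdd n) := by
    simp
  exact key _

/-- Morphisms `T ⟶ Spec ℤ[N]` are the monoid homomorphisms from `N` to the multiplicative
monoid of global functions on `T`. -/
def specCharEquiv (T : Scheme.{u}) :
    (T ⟶ Spec (intAlg N)) ≃ (Multiplicative N →* Γ(T, ⊤)) where
  toFun f := ((f.appTop.hom.comp (Scheme.ΓSpecIso (intAlg N)).inv.hom : _ →* _)).comp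
    (AddMonoidAlgebra.of (ULift.{u} ℤ) N)
  invFun χ := T.toSpecΓ ≫ Spec.map (charLift N Γ(T, ⊤) χ)
  left_inv f := by
    apply (ΓSpec.adjunction.homEquiv _ _).symm.injective
    apply Quiver.Hom.unop_inj
    rw [Adjunction.homEquiv_symm_apply, Adjunction.homEquiv_symm_apply]
    dsimp
    simp only [Scheme.toSpecΓ_appTop, Scheme.ΓSpecIso_naturality, Iso.inv_hom_id_assoc]
    apply intAlg_hom_ext
    intro n
    exact charLift_single N _ _ n
  right_inv χ := by
    ext n
    simpa using! charLift_single N _ χ n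

lemma specCharEquiv_comp {T T' : Scheme.{u}} (g : T' ⟶ T) (f : T ⟶ Spec (intAlg N)) :
    specCharEquiv N T' (g ≫ f) =
      (g.appTop.hom : Γ(T, ⊤) →* Γ(T', ⊤)).comp (specCharEquiv N T f) := by
  ext n
  simp [specCharEquiv]
  rfl

variable (S : Scheme.{u})

/-- The diagonalizable monoid scheme `A(N)_S = S × Spec ℤ[N]`, as a scheme over `S`. -/
def diagScheme : Over S :=
  Over.mk (pullback.fst (terminal.from S) (terminal.from (Spec (intAlg N))))

/-- The `T`-points of `A(N)_S` are the monoid homomorphisms `N → (Γ(T, 𝒪), ·)`. -/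
def charEquiv (T : Over S) :
    (T ⟶ diagScheme N S) ≃ (Multiplicative N →* Γ(T.left, ⊤)) where
  toFun f := specCharEquiv N T.left (f.left ≫ pullback.snd _ _)
  invFun χ := Over.homMk
    (pullback.lift T.hom ((specCharEquiv N T.left).symm χ) (Subsingleton.elim _ _))
    (by exact pullback.lift_fst _ _ _)
  left_inv f := by
    ext : 1
    apply pullback.hom_ext
    · exact (pullback.lift_fst _ _ _).trans (Over.w f).symm
    · exact (pullback.lift_snd _ _ _).trans ((specCharEquiv N T.left).symm_apply_apply _)
  right_inv χ := (congrArg (specCharEquiv N T.left) (pullback.lift_snd _ _ _)).trans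
    ((specCharEquiv N T.left).apply_symm_apply χ)

lemma charEquiv_comp {T T' : Over S} (f : T' ⟶ T) (g : T ⟶ diagScheme N S) :
    charEquiv N S T' (f ≫ g) =
      (f.left.appTop.hom : Γ(T.left, ⊤) →* Γ(T'.left, ⊤)).comp (charEquiv N S T g) := by
  refine Eq.trans ?_ (specCharEquiv_comp N f.left (g.left ≫ pullback.snd _ _))
  exact congrArg (specCharEquiv N _) (Category.assoc _ _ _)

/-- The functor of characters `T ↦ Hom(N, (Γ(T, 𝒪), ·))`, with pointwise multiplication. -/
def charFunctor : (Over S)ᵒᵖ ⥤ MonCat.{u} where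
  obj T := MonCat.of (Multiplicative N →* Γ(T.unop.left, ⊤))
  map f := MonCat.ofHom (MonoidHom.compHom (f.unop.left.appTop.hom : _ →* _))
  map_id T := by ext χ n; simp
  map_comp f g := by ext χ n; simp; rfl

/-- `A(N)_S` represents the functor of characters. -/
def diagRepresentableBy : (charFunctor N S ⋙ forget _).RepresentableBy (diagScheme N S) where
  homEquiv {T} := charEquiv N S T
  homEquiv_comp f g := charEquiv_comp N S f g

/-- The monoid scheme structure of `A(N)_S`: on `T`-points it is the pointwise multiplication of
the characters `N → (Γ(T, 𝒪), ·)`. -/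
instance : MonObj (diagScheme N S) :=
  MonObj.ofRepresentableBy _ (charFunctor N S) (diagRepresentableBy N S)

lemma charEquiv_one (T : Over S) : charEquiv N S T 1 = 1 := by
  refine ((diagRepresentableBy N S).homEquiv'_comp (toUnit T) MonObj.one).trans ?_
  rw [MonObj.ofRepresentableBy_one, Equiv.apply_symm_apply, map_one]
  rfl

lemma charEquiv_mul {T : Over S} (a b : T ⟶ diagScheme N S) :
    charEquiv N S T (a * b) = charEquiv N S T a * charEquiv N S T b := by
  refine ((diagRepresentableBy N S).homEquiv'_comp (lift a b) MonObj.mul).trans ?_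
  rw [MonObj.ofRepresentableBy_mul, Equiv.apply_symm_apply, map_mul,
    ← (diagRepresentableBy N S).homEquiv'_comp, ← (diagRepresentableBy N S).homEquiv'_comp,
    lift_fst, lift_snd]
  rfl

variable {N}

/-- The morphism `A(N')_S ⟶ A(N)_S` induced by a homomorphism of monoids `N → N'`. -/
def diagMap {N' : Type u} [AddCommMonoid N'] (i : N →+ N') : diagScheme N' S ⟶ diagScheme N S :=
  (charEquiv N S _).symm ((charEquiv N' S _ (𝟙 _)).comp (AddMonoidHom.toMultiplicative i))

/-- On points, `A(N')_S ⟶ A(N)_S` is the restriction of characters along `N → N'`. -/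
lemma charEquiv_diagMap {N' : Type u} [AddCommMonoid N'] (i : N →+ N') {T : Over S}
    (a : T ⟶ diagScheme N' S) :
    charEquiv N S T (a ≫ diagMap S i) =
      (charEquiv N' S T a).comp (AddMonoidHom.toMultiplicative i) := by
  rw [charEquiv_comp, diagMap, Equiv.apply_symm_apply, ← MonoidHom.comp_assoc, ← charEquiv_comp,
    Category.comp_id]

lemma charEquiv_neg_mul (M : Type u) [AddCommGroup M] :
    (𝟙 (diagScheme M S) ≫ diagMap S (negAddMonoidHom : M →+ M)) * 𝟙 (diagScheme M S) = 1 ∧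
    𝟙 (diagScheme M S) * (𝟙 (diagScheme M S) ≫ diagMap S (negAddMonoidHom : M →+ M)) = 1 := by
  constructor <;>
  · apply (charEquiv M S _).injective
    rw [charEquiv_mul, charEquiv_one, charEquiv_diagMap]
    ext m
    refine (map_mul (charEquiv M S _ (𝟙 (diagScheme M S))) _ _).symm.trans ?_
    refine (congrArg _ ?_).trans (map_one (charEquiv M S _ (𝟙 (diagScheme M S))))
    apply Multiplicative.toAdd.injective
    simp

/-- For an abelian group `M`, the diagonalizable monoid scheme `D(M)_S = A(M)_S` is a group scheme;
the inverse is induced by `m ↦ -m`. -/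
instance (M : Type u) [AddCommGroup M] : GrpObj (diagScheme M S) where
  inv := diagMap S (negAddMonoidHom : M →+ M)
  left_inv := by simpa using! (charEquiv_neg_mul S M).1
  right_inv := by simpa using! (charEquiv_neg_mul S M).2

/-- The multiplicative group `𝔾_{m,S} = D(ℤ)_S`. -/
abbrev Gm : Over S := diagScheme (ULift.{u} ℤ) S

/-- The affine line `𝔸¹_S = A(ℕ)_S`, with its multiplicative monoid structure. -/
abbrev A1 : Over S := diagScheme (ULift.{u} ℕ) S

/-- The inclusion `ℕ ⊆ ℤ`. -/
def natToInt : ULift.{u} ℕ →+ ULift.{u} ℤ :=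
  (AddEquiv.ulift.symm.toAddMonoidHom.comp (Nat.castAddMonoidHom ℤ)).comp
    AddEquiv.ulift.toAddMonoidHom

end Diagonalizable

/-! ### Separated algebraic spaces -/

section AlgebraicSpace

variable {S : Scheme.{u}}

/-- Morphisms of schemes over `S` that are surjective and étale. -/
def surjectiveEtale : MorphismProperty (Over S) :=
  fun _ _ f => Surjective f.left ∧ Etale f.left

/-- Morphisms of schemes over `S` that are closed immersions. -/
def closedImmersion : MorphismProperty (Over S) :=
  fun _ _ f => IsClosedImmersion f.left

/-- An algebraic space over `S`: an fppf sheaf on schemes over `S` whose diagonal is representable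
by schemes and which admits a surjective étale morphism from a scheme over `S`. -/
structure IsAlgebraicSpace (X : (Over S)ᵒᵖ ⥤ Type u) : Prop where
  isSheaf : Presieve.IsSheaf (Scheme.fppfTopology.over S) X
  representable_diag : yoneda.relativelyRepresentable (lift (𝟙 X) (𝟙 X))
  exists_etale_cover : ∃ (U : Over S) (p : yoneda.obj U ⟶ X),
    surjectiveEtale.presheaf p

/-- A separated algebraic space over `S`: the diagonal `X ⟶ X ×_S X` (the product of presheaves on
schemes over `S`) is a closed immersion. -/
structure IsSeparatedAlgebraicSpace (X : (Over S)ᵒᵖ ⥤ Type u) : Prop extends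
    IsAlgebraicSpace X where
  diag_isClosedImmersion : closedImmersion.presheaf (lift (𝟙 X) (𝟙 X))

end AlgebraicSpace

/-! ### Actions and attractors -/

section Attractor

variable {S : Scheme.{u}}

/-- An `S`-action of a group scheme `G` over `S` on a presheaf `X` on schemes over `S`: a functorial
action of the group `G(T)` on the set `X(T)` for all `T` over `S`. -/
structure GroupAction (G : Over S) [GrpObj G] (X : (Over S)ᵒᵖ ⥤ Type u) where
  /-- the action on `T`-points -/
  smul {T : Over S} (g : T ⟶ G) (x : X.obj (op T)) : X.obj (op T)
  one_smul {T : Over S} (x : X.obj (op T)) : smul 1 x = x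
  mul_smul {T : Over S} (g h : T ⟶ G) (x : X.obj (op T)) : smul (g * h) x = smul g (smul h x)
  map_smul {T' T : Over S} (t : T' ⟶ T) (g : T ⟶ G) (x : X.obj (op T)) :
    X.map t.op (smul g x) = smul (t ≫ g) (X.map t.op x)

/-- The action of `H` on `X` obtained from an action of `G` through a homomorphism `H ⟶ G`. -/
def GroupAction.comp {G H : Over S} [GrpObj G] [GrpObj H] {X : (Over S)ᵒᵖ ⥤ Type u}
    (ρ : GroupAction G X) (l : H ⟶ G) [IsMonHom l] : GroupAction H X where
  smul h x := ρ.smul (h ≫ l) x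
  one_smul x := by
    rw [show (1 : _ ⟶ H) ≫ l = 1 from (IsMonHom.monoidHom l _).map_one, ρ.one_smul]
  mul_smul g h x := by
    rw [show (g * h) ≫ l = (g ≫ l) * (h ≫ l) from (IsMonHom.monoidHom l _).map_mul g h, ρ.mul_smul]
  map_smul t g x := by rw [ρ.map_smul, Category.assoc]

variable {M : Type u} [AddCommGroup M] {X : (Over S)ᵒᵖ ⥤ Type u}

/-- The attractor attached to a homomorphism of monoids `i : N → M` and an action of `D(M)_S` on
`X`: the functor sending `T` over `S` to the set of `D(M)_T`-equivariant `T`-morphisms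
`φ : A(N)_T ⟶ X_T`, where `D(M)` acts on `A(N)` by multiplication through `D(M)_S ⟶ A(N)_S`.
A `T`-morphism `A(N)_T ⟶ X_T` is an `S`-morphism `A(N)_S ×_S T ⟶ X`, that is, an element of
`X(A(N)_S ×_S T)`; equivariance is expressed on points `(a, t)` of `A(N)_S ×_S T`. -/
def attractor {N : Type u} [AddCommMonoid N] (i : N →+ M) (ρ : GroupAction (diagScheme M S) X) :
    (Over S)ᵒᵖ ⥤ Type u where
  obj T := {φ : X.obj (op (diagScheme N S ⊗ T.unop)) //
    ∀ (T' : Over S) (g : T' ⟶ diagScheme M S) (a : T' ⟶ diagScheme N S) (t : T' ⟶ T.unop),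
      X.map (lift ((g ≫ diagMap S i) * a) t).op φ = ρ.smul g (X.map (lift a t).op φ)}
  map {T₁ T₂} f := ↾fun φ => ⟨X.map (diagScheme N S ◁ f.unop).op φ.1, fun T' g a t => by
    have h (b : T' ⟶ diagScheme N S) : X.map (lift b t).op (X.map (diagScheme N S ◁ f.unop).op φ.1) =
        X.map (lift b (t ≫ f.unop)).op φ.1 := by
      rw [← Functor.map_comp_apply, ← op_comp, lift_whiskerLeft]
    rw [h, h, φ.2]⟩
  map_id T := by ext φ; simp
  map_comp f g := by ext φ; simp

/-- The morphism from the attractor to `X` given by evaluation at `1 ∈ A(N)`. -/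
def attractorToSpace {N : Type u} [AddCommMonoid N] (i : N →+ M)
    (ρ : GroupAction (diagScheme M S) X) : attractor i ρ ⟶ X where
  app T := ↾fun φ => X.map (lift 1 (𝟙 T.unop)).op φ.1
  naturality T₁ T₂ f := by
    ext φ
    have h : lift (1 : T₂.unop ⟶ diagScheme N S) (𝟙 T₂.unop) ≫ diagScheme N S ◁ f.unop =
        f.unop ≫ lift 1 (𝟙 T₁.unop) := by
      rw [lift_whiskerLeft, comp_lift, MonObj.comp_one, Category.id_comp, Category.comp_id]
    have h' := congrArg (fun u => X.map (Quiver.Hom.op u) φ.1) h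
    simp only [op_comp, Functor.map_comp_apply] at h'
    exact h'

/-- The magnetic attractor `X^N` of a magnet (a submonoid) `N` of `M`. -/
abbrev magnetAttractor (ρ : GroupAction (diagScheme M S) X) (N : AddSubmonoid M) :
    (Over S)ᵒᵖ ⥤ Type u := attractor N.subtype ρ

/-- The morphism `X^N ⟶ X`, evaluation at `1`. -/
abbrev magnetToSpace (ρ : GroupAction (diagScheme M S) X) (N : AddSubmonoid M) :
    magnetAttractor ρ N ⟶ X := attractorToSpace N.subtype ρ

/-- The attractor `X⁺` of an action of `𝔾_{m,S}`: the functor of `𝔾_m`-equivariant morphisms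
`𝔸¹_T ⟶ X_T`. -/
abbrev plusAttractor (ρ : GroupAction (Gm S) X) : (Over S)ᵒᵖ ⥤ Type u := attractor natToInt ρ

/-- The morphism `X⁺ ⟶ X`, evaluation at `1`. -/
abbrev plusToSpace (ρ : GroupAction (Gm S) X) : plusAttractor ρ ⟶ X :=
  attractorToSpace natToInt ρ

/-- Two spaces `F` and `F'` over `X`, embedded by `p` and `q`, are equal as subspaces of `X`: they
are isomorphic over `X`. -/
def EqualIn {F F' X : (Over S)ᵒᵖ ⥤ Type u} (p : F ⟶ X) (q : F' ⟶ X) : Prop :=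
  ∃ e : F ≅ F', e.hom ≫ q = p

/-- A magnet `N` is lambdafiable if `X^{f⁻¹(ℕ)} = X^N` for some homomorphism `f : M → ℤ`. -/
def IsLambdafiable (ρ : GroupAction (diagScheme M S) X) (N : AddSubmonoid M) : Prop :=
  ∃ f : M →+ ℤ,
    EqualIn (magnetToSpace ρ ((AddSubmonoid.nonneg ℤ).comap f)) (magnetToSpace ρ N)

end Attractor
end Magnetism
end

noncomputable section

namespace Magnetism

/-! ### Calculus of characters: homomorphisms between diagonalizable monoid schemes -/

section DiagMap

variable {S : Scheme.{u}} {N N' N'' : Type u} [AddCommMonoid N] [AddCommMonoid N']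
  [AddCommMonoid N'']

/-! Dividing `f` by the positive generator of its image does not change `f⁻¹(ℕ)`, and the quotient
`g : M → ℤ` is either zero or has a section `s` (`exists_split_comap_nonneg_eq`). Put `N' = g⁻¹(ℕ)`
and `λ = D(g)`; it remains to compare `X⁺` with `X^{N'}`.

If `g` is split, then `N' = ker g ⊕ ℕ`, so `A(N') = D(ker g) × 𝔸¹`. A `D(M)`-equivariant morphism on
`A(N')` is determined by its restriction to `𝔸¹`, and a `𝔾_m`-equivariant `φ` on `𝔸¹` extends by `a
↦ k(a) · φ(s'(a))`, where `k` comes from the projection `m ↦ m - s(g m)` onto `ker g`.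

If `g = 0`, then `N' = M`, `X^M = X` and `λ` is trivial, so every `𝔾_m`-invariant morphism `𝔸¹_T ⟶
X` has to be constant. This is where separatedness enters: two morphisms agree on a closed
subscheme, and `𝔾_{m,T}` is schematically dense in `𝔸¹_T` (`eq_of_map_diagMap_eq`).

`equalIn_attractor` covers both cases; its last hypothesis is trivial in the first and is the
constancy statement in the second. -/

lemma diag_hom_ext {T : Over S} {a b : T ⟶ diagScheme N S}
    (h : ∀ n, charEquiv N S T a n = charEquiv N S T b n) : a = b :=
  (charEquiv N S T).injective (MonoidHom.ext h)

lemma diagMap_mul (i : N →+ N') {T : Over S} (a b : T ⟶ diagScheme N' S) :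
    (a * b) ≫ diagMap S i = (a ≫ diagMap S i) * (b ≫ diagMap S i) := by
  refine diag_hom_ext fun n => ?_
  simp [charEquiv_diagMap, charEquiv_mul]

lemma diagMap_one (i : N →+ N') {T : Over S} :
    (1 : T ⟶ diagScheme N' S) ≫ diagMap S i = 1 := by
  refine diag_hom_ext fun n => ?_
  simp [charEquiv_diagMap, charEquiv_one]

lemma diagMap_diagMap (i : N →+ N') (j : N' →+ N'') :
    diagMap S j ≫ diagMap S i = diagMap S (j.comp i) := by
  refine diag_hom_ext fun n => ?_
  rw [charEquiv_diagMap, ← Category.id_comp (diagMap S j),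
    ← Category.id_comp (diagMap S (j.comp i)), charEquiv_diagMap, charEquiv_diagMap]
  rfl

lemma diagMap_id : diagMap S (AddMonoidHom.id N) = 𝟙 _ := by
  refine diag_hom_ext fun n => ?_
  rw [← Category.id_comp (diagMap S _), charEquiv_diagMap]
  rfl

lemma diagMap_zero {T : Over S} (a : T ⟶ diagScheme N' S) :
    a ≫ diagMap S (0 : N →+ N') = 1 := by
  refine diag_hom_ext fun n => ?_
  rw [charEquiv_diagMap, charEquiv_one]
  exact map_one (charEquiv N' S T a)

lemma diag_mul_diagMap (i j : N →+ N') {T : Over S} (a : T ⟶ diagScheme N' S) :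
    (a ≫ diagMap S i) * (a ≫ diagMap S j) = a ≫ diagMap S (i + j) := by
  refine diag_hom_ext fun n => ?_
  rw [charEquiv_mul, charEquiv_diagMap, charEquiv_diagMap, charEquiv_diagMap]
  exact (map_mul (charEquiv N' S T a) _ _).symm

lemma diag_mul_comm {T : Over S} (a b : T ⟶ diagScheme N S) : a * b = b * a := by
  refine diag_hom_ext fun n => ?_
  simp [charEquiv_mul, mul_comm]

instance isMonHom_diagMap (i : N →+ N') : IsMonHom (diagMap S i) where
  one_hom := by
    rw [MonObj.one_eq_one, diagMap_one, MonObj.one_eq_one]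
  mul_hom := by
    rw [MonObj.mul_eq_mul, diagMap_mul]
    simp [Hom.mul_def]

end DiagMap

/-! ### Comparing attractors by restriction and extension -/

section Attractor

variable {S : Scheme.{u}} {M B : Type u} [AddCommGroup M] [AddCommGroup B]
  {X : (Over S)ᵒᵖ ⥤ Type u} {N A : Type u} [AddCommMonoid N] [AddCommMonoid A]

lemma map_lift_map_whiskerRight {T T' : Over S} {G H : Over S} (m : G ⟶ H) (b : T' ⟶ G)
    (t : T' ⟶ T) (x : X.obj (op (H ⊗ T))) :
    X.map (lift b t).op (X.map (m ▷ T).op x) = X.map (lift (b ≫ m) t).op x := by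
  rw [← Functor.map_comp_apply, ← op_comp, lift_whiskerRight]

lemma attractor_equivariant {ρ : GroupAction (diagScheme M S) X} {i : N →+ M} {T T' : Over S}
    (φ : (attractor i ρ).obj (op T)) (g : T' ⟶ diagScheme M S) (a : T' ⟶ diagScheme N S)
    (t : T' ⟶ T) :
    X.map (lift ((g ≫ diagMap S i) * a) t).op φ.1 = ρ.smul g (X.map (lift a t).op φ.1) :=
  φ.2 T' g a t

/-- Change of the monoid in an attractor along `p : N → A`, from the action of `D(M)` to that of
`D(B)` through a homomorphism `f : M → B` compatible with `p`. -/
def attractorRestrict (ρ : GroupAction (diagScheme M S) X) {i : N →+ M} {j : A →+ B} (f : M →+ B)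
    (p : N →+ A) (hp : j.comp p = f.comp i) :
    attractor i ρ ⟶ attractor j (ρ.comp (diagMap S f)) where
  app T := ↾fun φ => ⟨X.map (diagMap S p ▷ T.unop).op φ.1, fun T' g a t => by
    rw [map_lift_map_whiskerRight, map_lift_map_whiskerRight, diagMap_mul, Category.assoc,
      diagMap_diagMap, hp, ← diagMap_diagMap, ← Category.assoc]
    exact attractor_equivariant φ _ _ _⟩
  naturality T₁ T₂ t := by
    ext φ
    apply Subtype.ext
    change X.map _ (X.map _ φ.1) = X.map _ (X.map _ φ.1)
    rw [← Functor.map_comp_apply, ← Functor.map_comp_apply, ← op_comp, ← op_comp,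
      whisker_exchange]

lemma map_lift_smul_map (ρ : GroupAction (diagScheme M S) X) (s' : A →+ N) (k : M →+ N)
    {T T' : Over S} (b : T' ⟶ diagScheme N S) (t : T' ⟶ T) (x : X.obj (op (diagScheme A S ⊗ T))) :
    X.map (lift b t).op (ρ.smul (fst _ _ ≫ diagMap S k) (X.map (diagMap S s' ▷ T).op x)) =
      ρ.smul (b ≫ diagMap S k) (X.map (lift (b ≫ diagMap S s') t).op x) := by
  rw [ρ.map_smul, map_lift_map_whiskerRight, lift_fst_assoc]

/-- Equivariance of the extension `a ↦ k(a) · φ(s'(a))`. By `hs`, the point `s'(g a)` is `s(g) ·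
s'(a)`, so equivariance of `φ` extracts the part of `g` seen through `s` and `f`; by `hk` this part
and `k(g)` multiply to `g`. -/
lemma equivariant_extend (ρ : GroupAction (diagScheme M S) X) {i : N →+ M} {j : A →+ B}
    {f : M →+ B} {s : B →+ M} {s' : A →+ N} {k : M →+ N} (hs : i.comp s' = s.comp j)
    (hk : i.comp k + s.comp f = AddMonoidHom.id M) {T T' : Over S}
    (φ : (attractor j (ρ.comp (diagMap S f))).obj (op T))
    (g : T' ⟶ diagScheme M S) (a : T' ⟶ diagScheme N S) (t : T' ⟶ T) :
    ρ.smul (((g ≫ diagMap S i) * a) ≫ diagMap S k)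
        (X.map (lift (((g ≫ diagMap S i) * a) ≫ diagMap S s') t).op φ.1) =
      ρ.smul g (ρ.smul (a ≫ diagMap S k) (X.map (lift (a ≫ diagMap S s') t).op φ.1)) := by
  have hφ : X.map (lift (((g ≫ diagMap S i) * a) ≫ diagMap S s') t).op φ.1 =
      ρ.smul ((g ≫ diagMap S s) ≫ diagMap S f) (X.map (lift (a ≫ diagMap S s') t).op φ.1) := by
    rw [diagMap_mul, Category.assoc, diagMap_diagMap, hs, ← diagMap_diagMap, ← Category.assoc]
    exact attractor_equivariant φ (g ≫ diagMap S s) (a ≫ diagMap S s') t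
  have hg : (((g ≫ diagMap S i) * a) ≫ diagMap S k) * ((g ≫ diagMap S s) ≫ diagMap S f) =
      g * (a ≫ diagMap S k) := by
    rw [diagMap_mul, Category.assoc, Category.assoc, diagMap_diagMap, diagMap_diagMap,
      diag_mul_comm, ← mul_assoc, diag_mul_diagMap, add_comm, hk, diagMap_id, Category.comp_id]
  rw [hφ, ← ρ.mul_smul, ← ρ.mul_smul, hg]

/-- Extension of an equivariant morphism `A(A) ⟶ X` to `A(N)`, by `a ↦ k(a) · φ(s'(a))`. -/
def attractorExtend (ρ : GroupAction (diagScheme M S) X) {i : N →+ M} {j : A →+ B} (f : M →+ B)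
    (s : B →+ M) (s' : A →+ N) (k : M →+ N) (hs : i.comp s' = s.comp j)
    (hk : i.comp k + s.comp f = AddMonoidHom.id M) :
    attractor j (ρ.comp (diagMap S f)) ⟶ attractor i ρ where
  app T := ↾fun φ => ⟨ρ.smul (fst _ _ ≫ diagMap S k) (X.map (diagMap S s' ▷ T.unop).op φ.1),
    fun T' g a t => by
    rw [map_lift_smul_map, map_lift_smul_map]
    exact equivariant_extend ρ hs hk φ g a t⟩
  naturality T₁ T₂ t := by
    ext φ
    apply Subtype.ext
    change ρ.smul _ (X.map _ (X.map _ φ.1)) = X.map _ (ρ.smul _ (X.map _ φ.1))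
    rw [ρ.map_smul, ← Functor.map_comp_apply, ← Functor.map_comp_apply, ← op_comp, ← op_comp,
      whisker_exchange, whiskerLeft_fst_assoc]

/-- If `M` splits as `B` plus a group of units of `N`, then the attractors of `N` and `A` agree. -/
theorem equalIn_attractor (ρ : GroupAction (diagScheme M S) X) (i : N →+ M) (j : A →+ B)
    (f : M →+ B) (s : B →+ M) (p : N →+ A) (s' : A →+ N) (k : M →+ N)
    (hp : j.comp p = f.comp i) (hs : i.comp s' = s.comp j)
    (hk : i.comp k + s.comp f = AddMonoidHom.id M)
    (hk' : k.comp i + s'.comp p = AddMonoidHom.id N) (hpk : p.comp k = 0)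
    (h : ∀ (T : Over S) (φ : (attractor j (ρ.comp (diagMap S f))).obj (op T)),
      X.map (diagMap S (p.comp s') ▷ T).op φ.1 = φ.1) :
    EqualIn (attractorToSpace j (ρ.comp (diagMap S f))) (attractorToSpace i ρ) := by
  have e {G : Over S} (m : G ⟶ G) (T : Over S) : m ▷ T = lift (fst _ _ ≫ m) (snd _ _) := by
    ext <;> simp
  have hinv : attractorRestrict ρ f p hp ≫ attractorExtend ρ f s s' k hs hk = 𝟙 _ := by
    ext T φ
    apply Subtype.ext
    change ρ.smul _ (X.map _ (X.map _ φ.1)) = φ.1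
    rw [← Functor.map_comp_apply, ← op_comp, ← comp_whiskerRight, diagMap_diagMap, e]
    -- Equivariance absorbs the factor `k(a)` into the argument; by `hk'` the product of the two
    -- components is `a` itself.
    refine (attractor_equivariant φ _ _ _).symm.trans ?_
    rw [Category.assoc, diagMap_diagMap, diag_mul_diagMap, hk', diagMap_id, Category.comp_id,
      lift_fst_snd, op_id, Functor.map_id_apply]
  have hinv' : attractorExtend ρ f s s' k hs hk ≫ attractorRestrict ρ f p hp = 𝟙 _ := by
    ext T φ
    apply Subtype.ext
    change X.map _ (ρ.smul _ (X.map _ φ.1)) = φ.1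
    rw [ρ.map_smul, ← Functor.map_comp_apply, ← op_comp, ← comp_whiskerRight, diagMap_diagMap,
      whiskerRight_fst_assoc, diagMap_diagMap, hpk, diagMap_zero, ρ.one_smul]
    exact h _ φ
  -- Compatibility with evaluation is checked on the inverse, restriction, where it only says that
  -- the unit goes to the unit.
  refine (fun e he => ⟨e.symm, (Iso.inv_comp_eq e).2 he⟩ :
    ∀ e : attractor i ρ ≅ attractor j (ρ.comp (diagMap S f)), _ → _)
    ⟨attractorRestrict ρ f p hp, attractorExtend ρ f s s' k hs hk, hinv, hinv'⟩ ?_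
  ext T φ
  change X.map _ φ.1 = X.map _ (X.map _ φ.1)
  rw [map_lift_map_whiskerRight, diagMap_one]

lemma EqualIn.trans {F F' F'' : (Over S)ᵒᵖ ⥤ Type u} {p : F ⟶ X} {q : F' ⟶ X} {r : F'' ⟶ X}
    (h : EqualIn p q) (h' : EqualIn q r) : EqualIn p r := by
  obtain ⟨e, he⟩ := h
  obtain ⟨e', he'⟩ := h'
  exact ⟨e ≪≫ e', by rw [Iso.trans_hom, Category.assoc, he', he]⟩

end Attractor

/-! ### Schematic density of `A(B)_T` in `A(A)_T` and separatedness -/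

section ClosedImmersion

open TensorProduct

variable {A B : Type u} [AddCommMonoid A] [AddCommMonoid B]

section Algebra

variable (K : Type u) [CommRing K]

/-- The retraction kills the monomials outside the image of `j`. Unlike bare injectivity, a linear
retraction survives tensoring with any `R`, flat or not. -/
lemma exists_retraction_mapDomain (j : A →+ B) (hj : Function.Injective j) :
    ∃ r : AddMonoidAlgebra K B →ₗ[K] AddMonoidAlgebra K A,
      r ∘ₗ (AddMonoidAlgebra.mapDomainAlgHom K K j).toLinearMap = LinearMap.id := by
  let r := AddMonoidAlgebra.comapDomainAddMonoidHom (R := K) j hj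
  refine ⟨⟨r, fun n x => ?_⟩, ?_⟩
  · ext a
    simp [r]
  · ext a
    simp [r]

lemma tensor_mapDomain_injective (R : Type u) [CommRing R] [Algebra K R] (j : A →+ B)
    (hj : Function.Injective j) : Function.Injective (Algebra.TensorProduct.map (AlgHom.id K R)
      (AddMonoidAlgebra.mapDomainAlgHom K K j)) := by
  obtain ⟨r, hr⟩ := exists_retraction_mapDomain K j hj
  refine Function.LeftInverse.injective (g := r.lTensor R) fun x => ?_
  change (r.lTensor R ∘ₗ (AddMonoidAlgebra.mapDomainAlgHom K K j).toLinearMap.lTensor R) x = x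
  rw [← LinearMap.lTensor_comp, hr, LinearMap.lTensor_id, LinearMap.id_apply]

lemma isPullback_specTensor (hK : IsTerminal (Spec (CommRingCat.of K))) (R C : Type u) [CommRing R]
    [Algebra K R] [CommRing C] [Algebra K C] :
    IsPullback
      (Spec.map (CommRingCat.ofHom
        (Algebra.TensorProduct.includeLeftRingHom : R →+* R ⊗[K] C)))
      (Spec.map (CommRingCat.ofHom
        (Algebra.TensorProduct.includeRight.toRingHom : C →+* R ⊗[K] C)))
      (terminal.from (Spec (CommRingCat.of R))) (terminal.from (Spec (CommRingCat.of C))) := by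
  have := isIso_of_isTerminal hK terminalIsTerminal (terminal.from _)
  exact (isPullback_SpecMap_of_isPushout _ _ _ _ (CommRingCat.isPushout_tensorProduct
    K R C)).of_iso (Iso.refl _) (Iso.refl _)
    (Iso.refl _) (asIso (terminal.from _)) (by simp) (by simp) (terminal.hom_ext _ _)
    (terminal.hom_ext _ _)

/-- A closed subscheme of `Spec R × Spec C` containing the image of `Spec R × Spec D`, for a
homomorphism `C → D` injective after tensoring with `R`, is everything. -/
lemma isIso_of_isClosedImmersion_affine (hK : IsTerminal (Spec (CommRingCat.of K)))
    (R C D : Type u) [CommRing R] [Algebra K R] [CommRing C] [Algebra K C] [CommRing D]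
    [Algebra K D] (f : C →ₐ[K] D)
    (hf : Function.Injective (Algebra.TensorProduct.map (AlgHom.id K R) f)) {P Z : Scheme.{u}}
    {p : P ⟶ Spec (CommRingCat.of R)} {c : P ⟶ Spec (CommRingCat.of C)}
    (hp : IsPullback p c (terminal.from _) (terminal.from _)) (z : Z ⟶ P) [IsClosedImmersion z]
    (w : Spec (CommRingCat.of (R ⊗[K] D)) ⟶ Z)
    (hwp : w ≫ z ≫ p = Spec.map (CommRingCat.ofHom Algebra.TensorProduct.includeLeftRingHom))
    (hwc : w ≫ z ≫ c =
      Spec.map (CommRingCat.ofHom Algebra.TensorProduct.includeRight.toRingHom) ≫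
        Spec.map (CommRingCat.ofHom f.toRingHom)) : IsIso z := by
  let m := CommRingCat.ofHom (Algebra.TensorProduct.map (AlgHom.id K R) f).toRingHom
  let e := (isPullback_specTensor K hK R C).isoIsPullback _ _ hp
  have hm : Function.Injective m := hf
  have : IsAffine P := .of_isIso e.inv
  have hw : w ≫ z = Spec.map m ≫ e.hom := by
    apply hp.hom_ext
    · rw [Category.assoc, hwp, Category.assoc, IsPullback.isoIsPullback_hom_fst, ← Spec.map_comp]
      congr 1
      ext x
      simp [m]
    · rw [Category.assoc, hwc, Category.assoc, IsPullback.isoIsPullback_hom_snd, ← Spec.map_comp,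
        ← Spec.map_comp]
      congr 1
  apply IsClosedImmersion.isIso_of_injective_of_isAffine
  have hinj : Function.Injective (w ≫ z).appTop := by
    rw [hw, Scheme.Hom.comp_appTop]
    have h1 : Function.Injective (Spec.map m).appTop := by
      have := Scheme.ΓSpecIso_naturality m
      rw [← Iso.eq_comp_inv] at this
      rw [this]
      exact ((ConcreteCategory.bijective_of_isIso (Scheme.ΓSpecIso _).inv).1.comp hm).comp
        (ConcreteCategory.bijective_of_isIso (Scheme.ΓSpecIso _).hom).1
    have : IsIso e.hom.appTop := inferInstanceAs (IsIso (e.hom.app ⊤))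
    exact h1.comp (ConcreteCategory.bijective_of_isIso e.hom.appTop).1
  rw [Scheme.Hom.comp_appTop] at hinj
  -- Functions on `P` inject into those on the tensor product through `Z`, hence already into those
  -- on `Z`; a closed subscheme of an affine scheme with this property is everything.
  exact Function.Injective.of_comp (f := w.appTop) (by simpa using! hinj)

/-- A closed subscheme of `T × Spec K[A]` containing the image of `T × Spec K[B]`, for an injective
homomorphism `j : A → B` and `Spec K` terminal, is everything. -/
lemma isIso_of_isClosedImmersion_of_comp (hK : IsTerminal (Spec (CommRingCat.of K)))
    (j : A →+ B) (hj : Function.Injective j) {T P U Z : Scheme.{u}} {p : P ⟶ T}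
    {c : P ⟶ Spec (CommRingCat.of (AddMonoidAlgebra K A))}
    (hp : IsPullback p c (terminal.from _) (terminal.from _))
    {q : U ⟶ T} {d : U ⟶ Spec (CommRingCat.of (AddMonoidAlgebra K B))}
    (hq : IsPullback q d (terminal.from _) (terminal.from _))
    (z : Z ⟶ P) [IsClosedImmersion z] (w : U ⟶ Z) (hwp : w ≫ z ≫ p = q)
    (hwc : w ≫ z ≫ c = d ≫ Spec.map
      (CommRingCat.ofHom (AddMonoidAlgebra.mapDomainAlgHom K K j).toRingHom)) : IsIso z := by
  have key (R : CommRingCat.{u}) (t : Spec R ⟶ T) : IsIso (pullback.snd z (pullback.fst p t)) := by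
    let : Algebra K R := (Spec.preimage (hK.from (Spec R))).hom.toAlgebra
    let inl := Spec.map (CommRingCat.ofHom (Algebra.TensorProduct.includeLeftRingHom :
      R →+* R ⊗[K] AddMonoidAlgebra K B))
    let inr := Spec.map (CommRingCat.ofHom (Algebra.TensorProduct.includeRight.toRingHom :
      AddMonoidAlgebra K B →+* R ⊗[K] AddMonoidAlgebra K B))
    let u := hq.lift (inl ≫ t) inr (terminal.hom_ext _ _)
    have hu : (u ≫ w ≫ z) ≫ p = inl ≫ t := by
      rw [Category.assoc, Category.assoc, hwp, hq.lift_fst]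
    let v := pullback.lift (f := p) (g := t) (u ≫ w ≫ z) inl hu
    have hp' : IsPullback (pullback.snd p t) (pullback.fst p t ≫ c) (terminal.from _)
        (terminal.from _) := by
      simpa using! ((IsPullback.of_hasPullback p t).paste_horiz hp.flip).flip
    refine isIso_of_isClosedImmersion_affine K hK R (AddMonoidAlgebra K A)
      (AddMonoidAlgebra K B) (AddMonoidAlgebra.mapDomainAlgHom K K j)
      (tensor_mapDomain_injective K R j hj) hp' _
      (pullback.lift (u ≫ w) v (by rw [pullback.lift_fst, Category.assoc])) ?_ ?_
    · rw [pullback.lift_snd_assoc, pullback.lift_snd]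
    · rw [pullback.lift_snd_assoc, pullback.lift_fst_assoc, Category.assoc, Category.assoc, hwc,
        hq.lift_snd_assoc]
  -- Being an isomorphism is local on the target, and an affine cover of `T` pulls back to one of
  -- `P`.
  exact (IsZariskiLocalAtTarget.of_openCover (P := MorphismProperty.isomorphisms Scheme)
    (T.affineCover.pullback₁ p) fun i => key _ _ : MorphismProperty.isomorphisms Scheme z)

end Algebra

variable (S : Scheme.{u})

/-- The projection of `A(A)_S = S × Spec ℤ[A]` to `Spec ℤ[A]`. -/
def diagToSpec (A : Type u) [AddCommMonoid A] : (diagScheme A S).left ⟶ Spec (intAlg A) :=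
  pullback.snd _ _

lemma isPullback_diagScheme (A : Type u) [AddCommMonoid A] (T : Over S) :
    IsPullback (snd (diagScheme A S) T).left ((fst (diagScheme A S) T).left ≫ diagToSpec S A)
      (terminal.from _) (terminal.from (Spec (intAlg A))) := by
  have h : IsPullback (fst (diagScheme A S) T).left (snd (diagScheme A S) T).left
      (diagScheme A S).hom T.hom := IsPullback.of_hasPullback _ _
  have h' : IsPullback (diagScheme A S).hom (diagToSpec S A) (terminal.from S)
    (terminal.from (Spec (intAlg A))) := IsPullback.of_hasPullback _ _
  simpa using! (h.paste_horiz h'.flip).flip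

/-- The homomorphism `ℤ[A] → ℤ[B]` induced by `j : A → B`. -/
def intAlgMap (j : A →+ B) : intAlg A ⟶ intAlg B :=
  CommRingCat.ofHom (AddMonoidAlgebra.mapDomainAlgHom (ULift.{u} ℤ) (ULift.{u} ℤ) j).toRingHom

lemma specCharEquiv_comp_specMap (j : A →+ B) {T : Scheme.{u}} (f : T ⟶ Spec (intAlg B)) :
    specCharEquiv A T (f ≫ Spec.map (intAlgMap j)) =
      (specCharEquiv B T f).comp (AddMonoidHom.toMultiplicative j) := by
  refine MonoidHom.ext fun n => ?_
  have h := congrArg (fun φ => f.appTop (φ.hom (AddMonoidAlgebra.single n.toAdd 1)))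
    (Scheme.ΓSpecIso_inv_naturality (intAlgMap j))
  have hj : intAlgMap j (AddMonoidAlgebra.single n.toAdd 1) =
      AddMonoidAlgebra.single (j n.toAdd) 1 := by
    simp [intAlgMap]
  simp only [CommRingCat.hom_comp, RingHom.comp_apply, hj] at h
  rw [specCharEquiv_comp]
  exact h.symm

lemma diagMap_left_comp_diagToSpec (j : A →+ B) :
    (diagMap S j).left ≫ diagToSpec S A = diagToSpec S B ≫ Spec.map (intAlgMap j) := by
  apply (specCharEquiv A _).injective
  rw [specCharEquiv_comp_specMap]
  have h := charEquiv_diagMap S j (𝟙 (diagScheme B S))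
  rw [Category.id_comp] at h
  exact h.trans (congrArg (fun f => (specCharEquiv B _ f).comp _) (Category.id_comp _))

theorem isIso_of_closedImmersion_of_comp (j : A →+ B) (hj : Function.Injective j) {T Z : Over S}
    (z : Z ⟶ diagScheme A S ⊗ T) (hz : closedImmersion z) (w : diagScheme B S ⊗ T ⟶ Z)
    (h : w ≫ z = diagMap S j ▷ T) : IsIso z := by
  have : IsClosedImmersion z.left := hz
  have : IsIso z.left := by
    refine isIso_of_isClosedImmersion_of_comp _ specULiftZIsTerminal j hj
      (isPullback_diagScheme S A T) (isPullback_diagScheme S B T) z.left w.left ?_ ?_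
    · rw [← Over.comp_left, ← Over.comp_left, ← Category.assoc, h, whiskerRight_snd]
    · rw [← Category.assoc z.left, ← Category.assoc, ← Over.comp_left, ← Over.comp_left,
        ← Category.assoc w, h, whiskerRight_fst, Over.comp_left, Category.assoc, Category.assoc,
        diagMap_left_comp_diagToSpec]
      rfl
  exact (isIso_iff_of_reflects_iso z (Over.forget S)).1 this

/-- Two points of a separated algebraic space on `A(A)_T` agree if they agree on `A(B)_T`, for an
injective homomorphism `j : A → B`. -/
theorem eq_of_map_diagMap_eq {S : Scheme.{u}} {X : (Over S)ᵒᵖ ⥤ Type u}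
    (hX : IsSeparatedAlgebraicSpace X) (j : A →+ B) (hj : Function.Injective j) {T : Over S}
    (x y : X.obj (op (diagScheme A S ⊗ T)))
    (h : X.map (diagMap S j ▷ T).op x = X.map (diagMap S j ▷ T).op y) : x = y := by
  let g : yoneda.obj (diagScheme A S ⊗ T) ⟶ X ⊗ X :=
    lift (yonedaEquiv.symm x) (yonedaEquiv.symm y)
  let hΔ := hX.representable_diag
  have hz := hX.diag_isClosedImmersion.2 g _ _ (hΔ.isPullback g)
  -- The pullback of the diagonal along `(x, y)` is the closed locus where `x` and `y` agree; by
  -- `h`, `A(B)_T` factors through it.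
  let w := hΔ.lift (g := g) (yonedaEquiv.symm (X.map (diagMap S j ▷ T).op x)) (diagMap S j ▷ T) (by
    rw [comp_lift, Category.comp_id, comp_lift, yonedaEquiv_symm_naturality_left,
      yonedaEquiv_symm_naturality_left, h])
  have : IsIso (hΔ.snd g) := isIso_of_closedImmersion_of_comp S j hj _ hz w
    (hΔ.lift_snd _ _ _)
  have hg : g = yoneda.map (inv (hΔ.snd g)) ≫ hΔ.fst g ≫ lift (𝟙 X) (𝟙 X) := by
    rw [hΔ.w, ← Category.assoc, ← Functor.map_comp, IsIso.inv_hom_id]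
    exact (Category.id_comp g).symm
  apply yonedaEquiv.symm.injective
  have h1 : g ≫ fst _ _ = yonedaEquiv.symm x := lift_fst _ _
  have h2 : g ≫ snd _ _ = yonedaEquiv.symm y := lift_snd _ _
  rw [← h1, ← h2, hg, Category.assoc, Category.assoc, Category.assoc, Category.assoc, lift_fst,
    lift_snd]

end ClosedImmersion

/-! ### Normalizing the homomorphism to `ℤ` -/

section Splitting

/-- A homomorphism `f : M → ℤ` may be replaced, without changing `f⁻¹(ℕ)`, by one that is zero or
a split surjection. -/
lemma exists_split_comap_nonneg_eq {M : Type u} [AddCommGroup M] (f : M →+ ℤ) :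
    ∃ (g : M →+ ℤ) (s : ℤ →+ M),
      (AddSubmonoid.nonneg ℤ).comap g = (AddSubmonoid.nonneg ℤ).comap f ∧
        ((g = 0 ∧ s = 0) ∨ ∀ n, g (s n) = n) := by
  by_cases hf : f = 0
  · exact ⟨0, 0, by rw [hf], .inl ⟨rfl, rfl⟩⟩
  obtain ⟨a, ha⟩ := Int.subgroup_cyclic f.range
  rw [← AddSubgroup.zmultiples_eq_closure] at ha
  have hd (m : M) : |a| ∣ f m := by
    have : f m ∈ AddSubgroup.zmultiples a := ha ▸ ⟨m, rfl⟩
    rwa [Int.mem_zmultiples_iff, ← abs_dvd] at this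
  have ha0 : a ≠ 0 := fun h => hf <| by
    ext m
    simpa [h] using hd m
  have hpos : 0 < |a| := abs_pos.2 ha0
  obtain ⟨m₀, hm₀⟩ : |a| ∈ f.range := by
    rw [ha, Int.mem_zmultiples_iff, dvd_abs]
  let g : M →+ ℤ := ⟨⟨fun m => f m / |a|, by simp⟩, fun x y => by
    simpa using Int.add_ediv_of_dvd_left (hd x)⟩
  refine ⟨g, zmultiplesHom M m₀, ?_, .inr fun n => ?_⟩
  · ext m
    change 0 ≤ f m / |a| ↔ 0 ≤ f m
    exact Int.ediv_nonneg_iff_of_pos hpos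
  · have : g m₀ = 1 := by
      change f m₀ / |a| = 1
      rw [hm₀, Int.ediv_self hpos.ne']
    simp [this]

end Splitting

/-! ### Invariant morphisms are constant -/

section Constant

variable {S : Scheme.{u}} {M B : Type u} [AddCommGroup M] [AddCommGroup B]
  {X : (Over S)ᵒᵖ ⥤ Type u} {A : Type u} [AddCommMonoid A]

/-- On a separated algebraic space, morphisms from `A(A)` invariant under the schematically dense
`D(B)` are constant. -/
lemma map_diagMap_zero_eq (hX : IsSeparatedAlgebraicSpace X) (ρ : GroupAction (diagScheme M S) X)
    (j : A →+ B) (hj : Function.Injective j) {T : Over S}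
    (φ : (attractor j (ρ.comp (diagMap S (0 : M →+ B)))).obj (op T)) :
    X.map (diagMap S (0 : A →+ A) ▷ T).op φ.1 = φ.1 := by
  apply eq_of_map_diagMap_eq hX j hj
  have e {G H : Over S} (m : G ⟶ H) : m ▷ T = lift (fst _ _ ≫ m) (snd _ _) := by
    ext <;> simp
  rw [← Functor.map_comp_apply, ← op_comp, ← comp_whiskerRight, e, e, ← Category.assoc,
    diagMap_zero]
  -- Equivariance at `a = 1` gives `φ(g) = g · φ(1)`, which is `φ(1)` because the action is trivial.
  have h := attractor_equivariant φ (fst (diagScheme B S) T) 1 (snd _ _)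
  rw [mul_one] at h
  refine Eq.trans ?_ h.symm
  change _ = ρ.smul (_ ≫ _) _
  rw [diagMap_zero, ρ.one_smul]

end Constant
end Magnetism

end

/-! ### The main theorem -/

theorem mainTheorem4 {S : Scheme.{u}} {M : Type u} [AddCommGroup M] [AddGroup.FG M]
    {X : (Over S)ᵒᵖ ⥤ Type u} (hX : Magnetism.IsSeparatedAlgebraicSpace X)
    (ρ : Magnetism.GroupAction (Magnetism.diagScheme M S) X)
    (N : AddSubmonoid M) (hN : Magnetism.IsLambdafiable ρ N) :
    ∃ (l : Magnetism.Gm S ⟶ Magnetism.diagScheme M S) (_ : IsMonHom l),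
      Magnetism.EqualIn (Magnetism.plusToSpace (ρ.comp l)) (Magnetism.magnetToSpace ρ N) := by
  obtain ⟨f, hf⟩ := hN
  obtain ⟨g, s, hg, hgs⟩ := Magnetism.exists_split_comap_nonneg_eq f
  rw [← hg] at hf
  -- This weak form of splitting also holds for `g = s = 0`, and suffices for `m - s(g m)` to lie in
  -- `ker g`.
  have hgsg (m : M) : g (s (g m)) = g m := by
    obtain ⟨rfl, rfl⟩ | h := hgs
    · simp
    · rw [h]
  have hnn (n : ℕ) : 0 ≤ g (s n) := by
    obtain ⟨rfl, rfl⟩ | h := hgs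
    · simp
    · simp [h]
  let N' := (AddSubmonoid.nonneg ℤ).comap g
  let g' : M →+ ULift.{u} ℤ := AddEquiv.ulift.symm.toAddMonoidHom.comp g
  let s' : ULift.{u} ℤ →+ M := s.comp AddEquiv.ulift.toAddMonoidHom
  let p : N' →+ ULift.{u} ℕ :=
    { toFun n := ⟨(g n).toNat⟩
      map_zero' := by ext; simp
      map_add' x y := by
        ext
        simpa using Int.toNat_add x.2 y.2 }
  let s₀ : ULift.{u} ℕ →+ N' :=
    { toFun n := ⟨s n.down, hnn n.down⟩
      map_zero' := by ext; simp
      map_add' x y := by ext; simp }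
  let k : M →+ N' :=
    { toFun m := ⟨m - s (g m), by simp [N', hgsg]⟩
      map_zero' := by ext; simp
      map_add' x y := by ext; simp; abel }
  have hj : Function.Injective Magnetism.natToInt.{u} := fun x y h =>
    ULift.ext _ _ (Nat.cast_injective (R := ℤ) (congrArg ULift.down h))
  have hp (n : N') : ((p n).down : ℤ) = g n := Int.toNat_of_nonneg n.2
  refine ⟨Magnetism.diagMap S g', inferInstance, Magnetism.EqualIn.trans
    (Magnetism.equalIn_attractor ρ N'.subtype Magnetism.natToInt g' s' p s₀ k
      ?_ ?_ ?_ ?_ ?_ fun T φ => ?_) hf⟩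
  · ext n
    exact hp n
  · ext n
    rfl
  · ext m
    exact sub_add_cancel _ _
  · ext n
    change (n : M) - s (g n) + s ((p n).down : ℤ) = n
    rw [hp, sub_add_cancel]
  · ext m
    change (g (m - s (g m))).toNat = 0
    simp [hgsg]
  -- For `g = 0` the composite `p ∘ s₀` is zero and induces the constant endomorphism `1` of `𝔸¹`;
  -- otherwise it is the identity.
  · obtain ⟨rfl, rfl⟩ | h := hgs
    · have hps : p.comp s₀ = 0 := by
        ext n
        rfl
      rw [hps]
      exact Magnetism.map_diagMap_zero_eq hX ρ _ hj φ
    · have hps : p.comp s₀ = AddMonoidHom.id _ := by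
        ext n
        change (g (s (n.down : ℤ))).toNat = n.down
        rw [h, Int.toNat_natCast]
      rw [hps, Magnetism.diagMap_id]
      simp
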